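/- Let $\mathbb K$ be a field of characteristic zero and $\Xi$ a set of colors. Let $P$ be a $\Xi$-colored dg pseudo-cooperad over $\mathbb K$ (a cooperad without counit) with an ascending filtration by graded subcollections $0=\mathcal F^0P\subset\mathcal F^1P\subset\mathcal F^2P\subset\cdots$ such that $P=\bigcup_m\mathcal F^mP$, $\partial_P(\mathcal F^mP)\subset\mathcal F^{m-1}P$, and $\Delta_{\mathbf t}(\mathcal F^mP)\subset\sum_{m_1+\dots+m_k=m}\mathcal F^{m_1}P\otimes\cdots\otimes\mathcal F^{m_k}P$ for every comultiplication $\Delta_{\mathbf t}$ of $P$, where $\mathbf t$ is a $\Xi$-colored tree with $k$ nodal vertices. (If $\Xi$ is infinite, it is part of the notion of pseudo-cooperad that for each $x\in P$ only finitely many $\Delta_{\mathbf t}(x)$, $\mathbf t$ running over the isomorphism classes of trees with two nodal vertices and the leaves of $x$, are nonzero; for finite $\Xi$ this is automatic.) For a $\Xi$-colored dg operad $\mathcal O$ over $\mathbb K$ let $\mathrm{Conv}(P,\mathcal O)$ be the convolution dg Lie algebra: its elements of degree $p$ are the morphisms of collections $\varphi\colon P\to\mathcal O$ of degree $p$ (equivariant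 for the permutations of the inputs), $\partial\varphi=\partial_{\mathcal O}\circ\varphi-(-1)^{|\varphi|}\varphi\circ\partial_P$, and $[\varphi,\psi]=\varphi\bullet\psi-(-1)^{|\varphi||\psi|}\psi\bullet\varphi$ with $\varphi\bullet\psi=\sum_{\mathbf t}\mu_{\mathbf t}\circ(\varphi\otimes\psi)\circ\Delta_{\mathbf t}$, where $\mathbf t$ runs over the isomorphism classes of trees with two nodal vertices and given leaves, and $\mu_{\mathbf t}$ is the corresponding multiplication of $\mathcal O$. For $m\ge1$ put $\mathcal F_m\mathrm{Conv}(P,\mathcal O)=\{\varphi : \varphi|_{\mathcal F^{m-1}P}=0\}$. Proposition. Let $f\colon\mathcal A\to\mathcal B$ be a quasi-isomorphism of $\Xi$-colored dg operads over $\mathbb K$ and $m\ge1$. Then $\mathcal F_m\mathrm{Conv}(P,\mathcal A)$ and $\mathcal F_m\mathrm{Conv}(P,\mathcal B)$ are closed under the differentials and the brackets, and $f_*\colon\varphi\mapsto f\circ\varphi$ restricts to a map $$\mathcal F_m\mathrm{Conv}(P,\mathcal A)\longrightarrow\mathcal F_m\mathrm{Conv}(P,\mathcal B)$$ which preserves the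 degrees, the differentials and the brackets and induces an isomorphism on cohomology; that is, this restriction is a quasi-isomorphism of dg Lie algebras. -/

import Mathlib

open scoped TensorProduct

namespace ConvOperad

universe u w v v₁ v₂ v₃

/-! ## Graded subspaces, signs, cohomology -/

section Graded

variable {K : Type u} [Field K]
variable {M : Type*} [AddCommGroup M] [Module K M] {N : Type*} [AddCommGroup N] [Module K N]

/-- The image of `G ⊗ H` in `M ⊗ N`, for subspaces `G` of `M` and `H` of `N`. -/
def tensorSub (G : Submodule K M) (H : Submodule K N) : Submodule K (M ⊗[K] N) :=
  LinearMap.range (TensorProduct.map G.subtype H.subtype)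

/-- The subspace `∑_{i + j = k} G i ⊗ H j` of `M ⊗ N`. It is used for gradings (`ι = ℤ`) and for
ascending filtrations (`ι = ℕ`). -/
def tensorSum {ι : Type*} [Add ι] (G : ι → Submodule K M) (H : ι → Submodule K N) (k : ι) :
    Submodule K (M ⊗[K] N) :=
  ⨆ (p : ι × ι) (_ : p.1 + p.2 = k), tensorSub (G p.1) (H p.2)

/-- For a graded vector space `M = ⨁ G i`, the operator `v ↦ (-1) ^ (q * |v|) v`. -/
noncomputable def signTwist (G : ℤ → Submodule K M) (hG : DirectSum.IsInternal G) (q : ℤ) :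
    M →ₗ[K] M :=
  (DirectSum.toModule K ℤ M fun i => (q * i).negOnePow • (G i).subtype) ∘ₗ
    (LinearEquiv.ofBijective (DirectSum.coeLinearMap G) hG).symm.toLinearMap

theorem signTwist_of_mem (G : ℤ → Submodule K M) (hG : DirectSum.IsInternal G) (q i : ℤ) {x : M}
    (hx : x ∈ G i) : signTwist G hG q x = (q * i).negOnePow • x := by
  have h : (LinearEquiv.ofBijective (DirectSum.coeLinearMap G) hG).symm x
      = DirectSum.lof K ℤ (fun i => G i) i ⟨x, hx⟩ := by
    rw [LinearEquiv.symm_apply_eq]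
    exact (DirectSum.coeLinearMap_lof G i ⟨x, hx⟩).symm
  simp [signTwist, h, DirectSum.toModule_lof]

/-- The Koszul symmetry `v ⊗ w ↦ (-1) ^ (|v| * |w|) w ⊗ v`. With `ε v = (-1) ^ |v| v`, the sign is
produced by the operator `(1 ⊗ 1 + ε ⊗ 1 + 1 ⊗ ε - ε ⊗ ε) / 2`, see `koszulSwap_of_mem`. -/
noncomputable def koszulSwap (G : ℤ → Submodule K M) (hG : DirectSum.IsInternal G)
    (H : ℤ → Submodule K N) (hH : DirectSum.IsInternal H) : M ⊗[K] N →ₗ[K] N ⊗[K] M :=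
  (TensorProduct.comm K M N).toLinearMap ∘ₗ ((2 : K)⁻¹ •
    (LinearMap.id + TensorProduct.map (signTwist G hG 1) LinearMap.id
      + TensorProduct.map LinearMap.id (signTwist H hH 1)
      - TensorProduct.map (signTwist G hG 1) (signTwist H hH 1)))

theorem koszulSwap_of_mem [CharZero K] (G : ℤ → Submodule K M) (hG : DirectSum.IsInternal G)
    (H : ℤ → Submodule K N) (hH : DirectSum.IsInternal H) (i j : ℤ) {x : M} {y : N}
    (hx : x ∈ G i) (hy : y ∈ H j) :
    koszulSwap G hG H hH (x ⊗ₜ y) = (i * j).negOnePow • (y ⊗ₜ[K] x) := by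
  have h2 : (2 : K) ≠ 0 := two_ne_zero
  simp only [koszulSwap, LinearMap.comp_apply, LinearMap.smul_apply, LinearMap.sub_apply,
    LinearMap.add_apply, LinearMap.id_apply, TensorProduct.map_tmul,
    signTwist_of_mem G hG 1 i hx, signTwist_of_mem H hH 1 j hy, one_mul]
  rcases Int.even_or_odd i with hi | hi <;> rcases Int.even_or_odd j with hj | hj
  · rw [Int.negOnePow_even i hi, Int.negOnePow_even j hj, Int.negOnePow_even _ (hi.mul_right j)]
    simp only [one_smul, add_sub_cancel_right, ← two_smul K (x ⊗ₜ[K] y), smul_smul,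
      inv_mul_cancel₀ h2]
    simp
  · rw [Int.negOnePow_even i hi, Int.negOnePow_odd j hj, Int.negOnePow_even _ (hi.mul_right j)]
    simp only [one_smul, add_sub_cancel_right, ← two_smul K (x ⊗ₜ[K] y), smul_smul,
      inv_mul_cancel₀ h2]
    simp
  · rw [Int.negOnePow_odd i hi, Int.negOnePow_even j hj, Int.negOnePow_even _ (hj.mul_left i)]
    simp only [one_smul, Units.neg_smul, TensorProduct.neg_tmul, sub_neg_eq_add]
    rw [add_neg_cancel, zero_add, ← two_smul K (x ⊗ₜ[K] y), smul_smul, inv_mul_cancel₀ h2]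
    simp
  · rw [Int.negOnePow_odd i hi, Int.negOnePow_odd j hj, Int.negOnePow_odd _ (hi.mul hj)]
    simp only [one_smul, Units.neg_smul, TensorProduct.neg_tmul, TensorProduct.tmul_neg, neg_neg]
    rw [add_neg_cancel, zero_add, ← neg_add', ← two_smul K (x ⊗ₜ[K] y), smul_neg, smul_smul,
      inv_mul_cancel₀ h2]
    simp

/-- A cochain complex `⋯ → G i → G (i + 1) → ⋯`, presented by a family of subspaces `G i` of a vector
space and linear maps `d i` on it: `d i` carries `G i` to `G (i + 1)` and `d (i + 1) ∘ d i`
vanishes on `G i`. (The subspaces `G i` need not span the ambient space.) -/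
structure IsComplex (G : ℤ → Submodule K M) (d : ℤ → M →ₗ[K] M) : Prop where
  d_mem : ∀ i, ∀ x ∈ G i, d i x ∈ G (i + 1)
  d_d : ∀ i, ∀ x ∈ G i, d (i + 1) (d i x) = 0

/-- Cocycles of degree `i`. -/
def cocycles (G : ℤ → Submodule K M) (d : ℤ → M →ₗ[K] M) (i : ℤ) : Submodule K M :=
  G i ⊓ LinearMap.ker (d i)

/-- Coboundaries of degree `i`. -/
def coboundaries (G : ℤ → Submodule K M) (d : ℤ → M →ₗ[K] M) (i : ℤ) : Submodule K M :=
  (G (i - 1)).map (d (i - 1))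

/-- Cohomology in degree `i`. -/
abbrev Cohomology (G : ℤ → Submodule K M) (d : ℤ → M →ₗ[K] M) (i : ℤ) : Type _ :=
  cocycles G d i ⧸ (coboundaries G d i).submoduleOf (cocycles G d i)

/-- `f` is a cochain map of degree zero from `(G, d)` to `(H, d')`. -/
structure IsCochainMap (G : ℤ → Submodule K M) (d : ℤ → M →ₗ[K] M)
    (H : ℤ → Submodule K N) (d' : ℤ → N →ₗ[K] N) (f : M →ₗ[K] N) : Prop where
  map_mem : ∀ i, ∀ x ∈ G i, f x ∈ H i
  comm : ∀ i, ∀ x ∈ G i, f (d i x) = d' i (f x)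

/-- The map induced on cohomology. -/
def cohomologyMap {G : ℤ → Submodule K M} {d : ℤ → M →ₗ[K] M}
    {H : ℤ → Submodule K N} {d' : ℤ → N →ₗ[K] N} {f : M →ₗ[K] N}
    (hf : IsCochainMap G d H d' f) (i : ℤ) : Cohomology G d i →ₗ[K] Cohomology H d' i :=
  Submodule.mapQ _ _
    (f.restrict (p := cocycles G d i) (q := cocycles H d' i) (fun x hx =>
      ⟨hf.map_mem i x hx.1, by
        have h0 : d i x = 0 := hx.2
        have h1 := hf.comm i x hx.1
        rw [h0, map_zero] at h1
        exact h1.symm⟩))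
    (by
      rintro ⟨x, hx⟩ ⟨z, hz, hzx⟩
      exact ⟨f z, hf.map_mem _ z hz, by
        rw [← hf.comm _ z hz, hzx]
        rfl⟩)

/-- `f` is a quasi-isomorphism of cochain complexes. -/
def IsQuasiIso (G : ℤ → Submodule K M) (d : ℤ → M →ₗ[K] M)
    (H : ℤ → Submodule K N) (d' : ℤ → N →ₗ[K] N) (f : M →ₗ[K] N) : Prop :=
  IsComplex G d ∧ IsComplex H d' ∧
    ∃ hf : IsCochainMap G d H d' f, ∀ i, Function.Bijective (cohomologyMap hf i)

end Graded

/-! ## Coloured finite sets -/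

/-- A finite set whose elements (the incoming edges of a corolla) are coloured by `Ξ`. -/
structure CSet (Ξ : Type w) where
  carrier : Type
  [finite : Finite carrier]
  color : carrier → Ξ

attribute [instance] CSet.finite

/-- Colour-preserving bijections. -/
structure CIso {Ξ : Type w} (S T : CSet Ξ) where
  toEquiv : S.carrier ≃ T.carrier
  color_eq : ∀ s, T.color (toEquiv s) = S.color s

namespace CIso

variable {Ξ : Type w} {S T U : CSet Ξ}

def refl (S : CSet Ξ) : CIso S S := ⟨Equiv.refl _, fun _ => rfl⟩

def symm (e : CIso S T) : CIso T S :=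
  ⟨e.toEquiv.symm, fun t => by rw [← e.color_eq, Equiv.apply_symm_apply]⟩

def trans (e : CIso S T) (e' : CIso T U) : CIso S U :=
  ⟨e.toEquiv.trans e'.toEquiv, fun s => (e'.color_eq _).trans (e.color_eq s)⟩

end CIso

namespace CSet

variable {Ξ : Type w}

/-- One element, of colour `ξ`. -/
def single (ξ : Ξ) : CSet Ξ := ⟨Unit, fun _ => ξ⟩

/-- `(S ∖ {s}) ⊔ T`: the leaves of the tree with two vertices obtained by grafting the corolla
with inputs `T` into the input `s` of the corolla with inputs `S`. -/
def ins (S : CSet Ξ) (s : S.carrier) (T : CSet Ξ) : CSet Ξ :=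
  ⟨{x : S.carrier // x ≠ s} ⊕ T.carrier, Sum.elim (fun x => S.color x.1) T.color⟩

/-- Functoriality of `ins`. -/
def insMap {S S' T T' : CSet Ξ} (e : CIso S S') (s : S.carrier) (e' : CIso T T') :
    CIso (S.ins s T) (S'.ins (e.toEquiv s) T') where
  toEquiv := Equiv.sumCongr (e.toEquiv.subtypeEquiv fun _ => e.toEquiv.injective.ne_iff.symm)
    e'.toEquiv
  color_eq := by
    rintro (x | x)
    · exact e.color_eq x.1
    · exact e'.color_eq x

/-- `(S ∖ {s}) ⊔ {s} ≅ S`. -/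
noncomputable def insSingle (S : CSet Ξ) (s : S.carrier) {η : Ξ} (h : S.color s = η) :
    CIso (S.ins s (single η)) S where
  toEquiv := Equiv.ofBijective (Sum.elim (fun x => x.1) (fun _ => s) :
      {x : S.carrier // x ≠ s} ⊕ Unit → S.carrier) (by
    constructor
    · rintro (⟨x, hx⟩ | x) (⟨y, hy⟩ | y) hxy
      · obtain rfl : x = y := hxy
        rfl
      · exact absurd hxy hx
      · exact absurd hxy.symm hy
      · rfl
    · intro y
      by_cases hy : y = s
      · exact ⟨Sum.inr (), hy.symm⟩
      · exact ⟨Sum.inl ⟨y, hy⟩, rfl⟩)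
  color_eq := by
    rintro (x | x)
    · rfl
    · exact h

/-- `({*} ∖ {*}) ⊔ T ≅ T`. -/
noncomputable def singleIns (ξ : Ξ) (T : CSet Ξ) :
    CIso ((single ξ).ins () T) T :=
  CIso.symm
    { toEquiv := Equiv.ofBijective (Sum.inr :
        T.carrier → {x : Unit // x ≠ ()} ⊕ T.carrier) (by
          refine ⟨Sum.inr_injective, ?_⟩
          rintro (⟨x, hx⟩ | x)
          · exact absurd rfl hx
          · exact ⟨x, rfl⟩)
      color_eq := fun _ => rfl }

/-- Sequential grafting: `(((S ∖ {s}) ⊔ T) ∖ {t}) ⊔ U ≅ (S ∖ {s}) ⊔ ((T ∖ {t}) ⊔ U)`. -/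
def insAssoc (S : CSet Ξ) (s : S.carrier) (T : CSet Ξ) (t : T.carrier) (U : CSet Ξ) :
    CIso ((S.ins s T).ins (Sum.inr t) U) (S.ins s (T.ins t U)) where
  toEquiv :=
    { toFun := fun x => match x with
        | Sum.inl ⟨Sum.inl y, _⟩ => Sum.inl y
        | Sum.inl ⟨Sum.inr y, h⟩ => Sum.inr (Sum.inl ⟨y, fun e => h (congrArg Sum.inr e)⟩)
        | Sum.inr y => Sum.inr (Sum.inr y)
      invFun := fun x => match x with
        | Sum.inl y => Sum.inl ⟨Sum.inl y, Sum.inl_ne_inr⟩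
        | Sum.inr (Sum.inl y) => Sum.inl ⟨Sum.inr y.1, fun e => y.2 (Sum.inr_injective e)⟩
        | Sum.inr (Sum.inr y) => Sum.inr y
      left_inv := by rintro (⟨x | x, h⟩ | x) <;> rfl
      right_inv := by rintro (x | x | x) <;> rfl }
  color_eq := by rintro (⟨x | x, h⟩ | x) <;> rfl

/-- Parallel grafting: `(((S ∖ {s}) ⊔ T) ∖ {s'}) ⊔ U ≅ (((S ∖ {s'}) ⊔ U) ∖ {s}) ⊔ T`. -/
def insComm (S : CSet Ξ) (s s' : S.carrier) (hs : s' ≠ s) (T U : CSet Ξ) :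
    CIso ((S.ins s T).ins (Sum.inl ⟨s', hs⟩) U) ((S.ins s' U).ins (Sum.inl ⟨s, hs.symm⟩) T) where
  toEquiv :=
    { toFun := fun x => match x with
        | Sum.inl ⟨Sum.inl y, h⟩ => Sum.inl ⟨Sum.inl ⟨y.1, fun e =>
            h (congrArg Sum.inl (Subtype.ext e))⟩, fun e =>
            y.2 (congrArg Subtype.val (Sum.inl_injective e))⟩
        | Sum.inl ⟨Sum.inr y, _⟩ => Sum.inr y
        | Sum.inr y => Sum.inl ⟨Sum.inr y, Sum.inr_ne_inl⟩
      invFun := fun x => match x with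
        | Sum.inl ⟨Sum.inl y, h⟩ => Sum.inl ⟨Sum.inl ⟨y.1, fun e =>
            h (congrArg Sum.inl (Subtype.ext e))⟩, fun e =>
            y.2 (congrArg Subtype.val (Sum.inl_injective e))⟩
        | Sum.inl ⟨Sum.inr y, _⟩ => Sum.inr y
        | Sum.inr y => Sum.inl ⟨Sum.inr y, Sum.inr_ne_inl⟩
      left_inv := by rintro (⟨x | x, h⟩ | x) <;> rfl
      right_inv := by rintro (⟨x | x, h⟩ | x) <;> rfl }
  color_eq := by rintro (⟨x | x, h⟩ | x) <;> rfl

/-- A subset, with the induced colouring. -/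
def sub (R : CSet Ξ) (T : Set R.carrier) : CSet Ξ := ⟨{x // x ∈ T}, fun x => R.color x.1⟩

/-- `(R ∖ T) ⊔ {*}`, with `*` (written `none`) of colour `η`. -/
def quot (R : CSet Ξ) (T : Set R.carrier) (η : Ξ) : CSet Ξ :=
  ⟨Option {x // x ∉ T}, fun x => x.elim η fun y => R.color y.1⟩

/-- The tree with two vertices and set of leaves `R`, in which the leaves in `T` are attached to
the upper vertex and the inner edge has colour `η`. Up to isomorphism, these are all trees with
set of leaves `R` and two nodal vertices, each of them once. -/
noncomputable def join (R : CSet Ξ) (T : Set R.carrier) (η : Ξ) :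
    CIso ((R.quot T η).ins none (R.sub T)) R where
  toEquiv := Equiv.ofBijective
    (fun x : {x : Option {x // x ∉ T} // x ≠ none} ⊕ {x // x ∈ T} => match x with
      | Sum.inl ⟨some y, _⟩ => y.1
      | Sum.inl ⟨none, h⟩ => absurd rfl h
      | Sum.inr y => y.1) (by
    constructor
    · rintro (⟨_ | ⟨x, hx⟩, h⟩ | ⟨x, hx⟩) (⟨_ | ⟨y, hy⟩, h'⟩ | ⟨y, hy⟩) hxy
      · exact absurd rfl h
      · exact absurd rfl h
      · exact absurd rfl h
      · exact absurd rfl h'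
      · obtain rfl : x = y := hxy
        rfl
      · obtain rfl : x = y := hxy
        exact absurd hy hx
      · exact absurd rfl h'
      · obtain rfl : x = y := hxy
        exact absurd hx hy
      · obtain rfl : x = y := hxy
        rfl
    · intro y
      by_cases hy : y ∈ T
      · exact ⟨Sum.inr ⟨y, hy⟩, rfl⟩
      · exact ⟨Sum.inl ⟨some ⟨y, hy⟩, Option.some_ne_none _⟩, rfl⟩)
  color_eq := by
    rintro (⟨_ | x, h⟩ | x)
    · exact absurd rfl h
    · rfl
    · rfl

end CSet

/-! ## Dg collections, dg operads, dg pseudo-cooperads -/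

/-- A `Ξ`-coloured dg collection: a cochain complex `obj S ξ` for every corolla with (labelled)
inputs `S` and output of colour `ξ`, functorial in colour-preserving bijections of `S`. In
particular `obj S ξ` carries the action of the product of the symmetric groups that permute
inputs of the same colour. -/
structure DGCollection (K : Type u) [Field K] (Ξ : Type w) where
  obj : CSet Ξ → Ξ → Type v
  [addCommGroup : ∀ S ξ, AddCommGroup (obj S ξ)]
  [module : ∀ S ξ, Module K (obj S ξ)]
  gr : ∀ S ξ, ℤ → Submodule K (obj S ξ)
  internal : ∀ S ξ, DirectSum.IsInternal (gr S ξ)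
  d : ∀ S ξ, obj S ξ →ₗ[K] obj S ξ
  d_mem : ∀ S ξ i, ∀ x ∈ gr S ξ i, d S ξ x ∈ gr S ξ (i + 1)
  d_d : ∀ S ξ x, d S ξ (d S ξ x) = 0
  act : ∀ {S T : CSet Ξ} (_ : CIso S T) (ξ : Ξ), obj S ξ →ₗ[K] obj T ξ
  act_refl : ∀ S ξ x, act (CIso.refl S) ξ x = x
  act_trans : ∀ {S T U : CSet Ξ} (e : CIso S T) (e' : CIso T U) ξ x,
    act (e.trans e') ξ x = act e' ξ (act e ξ x)
  act_mem : ∀ {S T : CSet Ξ} (e : CIso S T) ξ i, ∀ x ∈ gr S ξ i, act e ξ x ∈ gr T ξ i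
  act_d : ∀ {S T : CSet Ξ} (e : CIso S T) ξ x, act e ξ (d S ξ x) = d T ξ (act e ξ x)

attribute [instance] DGCollection.addCommGroup DGCollection.module

/-- A `Ξ`-coloured dg operad (symmetric, with units), in terms of the elementary insertions
`a ∘_s b`, where the output colour `η` of `b` is the colour of the input `s` of `a`. -/
structure DGOperad (K : Type u) [Field K] (Ξ : Type w) extends DGCollection.{u, w, v} K Ξ where
  comp : ∀ {S : CSet Ξ} (s : S.carrier) (T : CSet Ξ) {η : Ξ} (_ : S.color s = η) (ξ : Ξ),
    obj S ξ →ₗ[K] obj T η →ₗ[K] obj (S.ins s T) ξ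
  comp_mem : ∀ {S : CSet Ξ} (s : S.carrier) (T : CSet Ξ) {η : Ξ} (h : S.color s = η) (ξ : Ξ)
    (i j : ℤ), ∀ a ∈ gr S ξ i, ∀ b ∈ gr T η j, comp s T h ξ a b ∈ gr (S.ins s T) ξ (i + j)
  comp_d : ∀ {S : CSet Ξ} (s : S.carrier) (T : CSet Ξ) {η : Ξ} (h : S.color s = η) (ξ : Ξ)
    (i : ℤ), ∀ a ∈ gr S ξ i, ∀ b : obj T η, d (S.ins s T) ξ (comp s T h ξ a b) =
      comp s T h ξ (d S ξ a) b + i.negOnePow • comp s T h ξ a (d T η b)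
  comp_act : ∀ {S S' T T' : CSet Ξ} (e : CIso S S') (e' : CIso T T') (s : S.carrier) {η : Ξ}
    (h : S.color s = η) (h' : S'.color (e.toEquiv s) = η) (ξ : Ξ) (a : obj S ξ) (b : obj T η),
    comp (e.toEquiv s) T' h' ξ (act e ξ a) (act e' η b) =
      act (CSet.insMap e s e') ξ (comp s T h ξ a b)
  comp_assoc : ∀ {S T U : CSet Ξ} (s : S.carrier) (t : T.carrier) {η θ : Ξ}
    (h : S.color s = η) (h' : T.color t = θ) (ξ : Ξ)
    (a : obj S ξ) (b : obj T η) (c : obj U θ),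
    act (CSet.insAssoc S s T t U) ξ
        (comp (S := S.ins s T) (Sum.inr t) U h' ξ (comp s T h ξ a b) c) =
      comp s (T.ins t U) h ξ a (comp t U h' η b c)
  comp_comm : ∀ {S T U : CSet Ξ} (s s' : S.carrier) (hs : s' ≠ s) {η θ : Ξ}
    (h : S.color s = η) (h' : S.color s' = θ) (ξ : Ξ) (i j : ℤ)
    (a : obj S ξ), ∀ b ∈ gr T η i, ∀ c ∈ gr U θ j,
    act (CSet.insComm S s s' hs T U) ξ
        (comp (S := S.ins s T) (Sum.inl ⟨s', hs⟩) U h' ξ (comp s T h ξ a b) c) =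
      (i * j).negOnePow •
        comp (S := S.ins s' U) (Sum.inl ⟨s, hs.symm⟩) T h ξ (comp s' U h' ξ a c) b
  unit : ∀ ξ : Ξ, obj (CSet.single ξ) ξ
  unit_mem : ∀ ξ, unit ξ ∈ gr (CSet.single ξ) ξ 0
  d_unit : ∀ ξ, d (CSet.single ξ) ξ (unit ξ) = 0
  comp_unit : ∀ {S : CSet Ξ} (s : S.carrier) {η : Ξ} (h : S.color s = η) (ξ : Ξ) (a : obj S ξ),
    act (CSet.insSingle S s h) ξ (comp s (CSet.single η) h ξ a (unit η)) = a
  unit_comp : ∀ (T : CSet Ξ) (ξ : Ξ) (b : obj T ξ),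
    act (CSet.singleIns ξ T) ξ
      (comp (S := CSet.single ξ) () T (η := ξ) rfl ξ (unit ξ) b) = b

/-- A `Ξ`-coloured dg pseudo-cooperad (no counit): the notion dual to that of a dg operad without
units. `comul s T` is the comultiplication `Δ_t` for the tree `t` with two vertices obtained by
grafting the corolla with inputs `T` into the input `s` of the corolla with inputs `S`; the
comultiplications for larger trees are the iterations of these. -/
structure DGPseudoCooperad (K : Type u) [Field K] (Ξ : Type w) extends
    DGCollection.{u, w, v} K Ξ where
  comul : ∀ {S : CSet Ξ} (s : S.carrier) (T : CSet Ξ) {η : Ξ} (_ : S.color s = η) (ξ : Ξ),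
    obj (S.ins s T) ξ →ₗ[K] obj S ξ ⊗[K] obj T η
  comul_mem : ∀ {S : CSet Ξ} (s : S.carrier) (T : CSet Ξ) {η : Ξ} (h : S.color s = η) (ξ : Ξ)
    (k : ℤ), ∀ x ∈ gr (S.ins s T) ξ k, comul s T h ξ x ∈ tensorSum (gr S ξ) (gr T η) k
  comul_d : ∀ {S : CSet Ξ} (s : S.carrier) (T : CSet Ξ) {η : Ξ} (h : S.color s = η) (ξ : Ξ)
    (x : obj (S.ins s T) ξ), comul s T h ξ (d (S.ins s T) ξ x) =
      TensorProduct.map (d S ξ) LinearMap.id (comul s T h ξ x) +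
      TensorProduct.map (signTwist (gr S ξ) (internal S ξ) 1) (d T η) (comul s T h ξ x)
  comul_act : ∀ {S S' T T' : CSet Ξ} (e : CIso S S') (e' : CIso T T') (s : S.carrier) {η : Ξ}
    (h : S.color s = η) (h' : S'.color (e.toEquiv s) = η) (ξ : Ξ) (x : obj (S.ins s T) ξ),
    comul (e.toEquiv s) T' h' ξ (act (CSet.insMap e s e') ξ x) =
      TensorProduct.map (act e ξ) (act e' η) (comul s T h ξ x)
  comul_assoc : ∀ {S T U : CSet Ξ} (s : S.carrier) (t : T.carrier) {η θ : Ξ}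
    (h : S.color s = η) (h' : T.color t = θ) (ξ : Ξ)
    (x : obj ((S.ins s T).ins (Sum.inr t) U) ξ),
    TensorProduct.map LinearMap.id (comul t U h' η)
        (comul s (T.ins t U) h ξ (act (CSet.insAssoc S s T t U) ξ x)) =
      TensorProduct.assoc K _ _ _ (TensorProduct.map (comul s T h ξ) LinearMap.id
        (comul (S := S.ins s T) (Sum.inr t) U h' ξ x))
  comul_comm : ∀ {S T U : CSet Ξ} (s s' : S.carrier) (hs : s' ≠ s) {η θ : Ξ}
    (h : S.color s = η) (h' : S.color s' = θ) (ξ : Ξ)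
    (x : obj ((S.ins s T).ins (Sum.inl ⟨s', hs⟩) U) ξ),
    TensorProduct.assoc K _ _ _ (TensorProduct.map (comul s' U h' ξ) LinearMap.id
        (comul (S := S.ins s' U) (Sum.inl ⟨s, hs.symm⟩) T h ξ
          (act (CSet.insComm S s s' hs T U) ξ x))) =
      TensorProduct.map LinearMap.id
        (koszulSwap (gr T η) (internal T η) (gr U θ) (internal U θ))
        (TensorProduct.assoc K _ _ _ (TensorProduct.map (comul s T h ξ) LinearMap.id
          (comul (S := S.ins s T) (Sum.inl ⟨s', hs⟩) U h' ξ x)))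
  /-- For each `x`, only finitely many of the `Δ_t x`, for `t` a tree with two vertices and leaves
  `R`, are nonzero. This holds automatically if there are only finitely many colours. -/
  comul_finite : ∀ (R : CSet Ξ) (ξ : Ξ) (x : obj R ξ),
    {p : Set R.carrier × Ξ | comul (S := R.quot p.1 p.2) none (R.sub p.1) (η := p.2) rfl ξ
      (act (R.join p.1 p.2).symm ξ x) ≠ 0}.Finite

/-- Morphisms of dg operads. -/
structure DGOperad.Hom {K : Type u} [Field K] {Ξ : Type w}
    (A : DGOperad.{u, w, v₂} K Ξ) (B : DGOperad.{u, w, v₃} K Ξ) where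
  app : ∀ (S : CSet Ξ) (ξ : Ξ), A.obj S ξ →ₗ[K] B.obj S ξ
  app_mem : ∀ S ξ i, ∀ x ∈ A.gr S ξ i, app S ξ x ∈ B.gr S ξ i
  app_d : ∀ S ξ x, app S ξ (A.d S ξ x) = B.d S ξ (app S ξ x)
  app_act : ∀ {S T : CSet Ξ} (e : CIso S T) ξ x, app T ξ (A.act e ξ x) = B.act e ξ (app S ξ x)
  app_comp : ∀ {S : CSet Ξ} (s : S.carrier) (T : CSet Ξ) {η : Ξ} (h : S.color s = η) (ξ : Ξ)
    (a : A.obj S ξ) (b : A.obj T η), app (S.ins s T) ξ (A.comp s T h ξ a b) =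
      B.comp s T h ξ (app S ξ a) (app T η b)
  app_unit : ∀ ξ, app (CSet.single ξ) ξ (A.unit ξ) = B.unit ξ

/-- A morphism of dg operads is a quasi-isomorphism if it is one on each `A(S; ξ)`. -/
def DGOperad.Hom.IsQuasiIso {K : Type u} [Field K] {Ξ : Type w}
    {A : DGOperad.{u, w, v₂} K Ξ} {B : DGOperad.{u, w, v₃} K Ξ} (f : A.Hom B) : Prop :=
  ∀ (S : CSet Ξ) (ξ : Ξ), ConvOperad.IsQuasiIso (A.gr S ξ) (fun _ => A.d S ξ)
    (B.gr S ξ) (fun _ => B.d S ξ) (f.app S ξ)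

namespace DGPseudoCooperad

variable {K : Type u} [Field K] {Ξ : Type w}

/-- An ascending, exhaustive filtration `0 = F 0 ⊆ F 1 ⊆ ...` of a dg pseudo-cooperad by graded
subcollections, such that the differential lowers the filtration by one and the comultiplications
are compatible with it. -/
structure Filtration (P : DGPseudoCooperad.{u, w, v} K Ξ) where
  F : ℕ → ∀ (S : CSet Ξ) (ξ : Ξ), Submodule K (P.obj S ξ)
  graded : ∀ m S ξ, F m S ξ = ⨆ i, F m S ξ ⊓ P.gr S ξ i
  act_mem : ∀ m {S T : CSet Ξ} (e : CIso S T) ξ, ∀ x ∈ F m S ξ, P.act e ξ x ∈ F m T ξ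
  zero : ∀ S ξ, F 0 S ξ = ⊥
  mono : ∀ m S ξ, F m S ξ ≤ F (m + 1) S ξ
  exhaustive : ∀ S ξ (x : P.obj S ξ), ∃ m, x ∈ F m S ξ
  d_mem : ∀ m S ξ, ∀ x ∈ F (m + 1) S ξ, P.d S ξ x ∈ F m S ξ
  comul_mem : ∀ m {S : CSet Ξ} (s : S.carrier) (T : CSet Ξ) {η : Ξ} (h : S.color s = η) (ξ : Ξ),
    ∀ x ∈ F m (S.ins s T) ξ,
      P.comul s T h ξ x ∈ tensorSum (fun k => F k S ξ) (fun k => F k T η) m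

end DGPseudoCooperad

/-! ## The convolution Lie algebra -/

section Conv

variable {K : Type u} [Field K] {Ξ : Type w}

/-- Arbitrary families of linear maps `P(S; ξ) → O(S; ξ)`. -/
abbrev Families (P : DGPseudoCooperad.{u, w, v₁} K Ξ) (O : DGOperad.{u, w, v} K Ξ) :=
  ∀ (S : CSet Ξ) (ξ : Ξ), P.obj S ξ →ₗ[K] O.obj S ξ

/-- `Conv(P, O)` in degree `p`: the morphisms of collections of degree `p`, that is, the families
of linear maps of degree `p` which commute with colour-preserving bijections. -/
def conv (P : DGPseudoCooperad.{u, w, v₁} K Ξ) (O : DGOperad.{u, w, v} K Ξ) (p : ℤ) :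
    Submodule K (Families P O) where
  carrier := {φ | (∀ S ξ i, ∀ x ∈ P.gr S ξ i, φ S ξ x ∈ O.gr S ξ (i + p)) ∧
    ∀ (S T : CSet Ξ) (e : CIso S T) ξ x, φ T ξ (P.act e ξ x) = O.act e ξ (φ S ξ x)}
  add_mem' := by
    rintro φ ψ ⟨h1, h2⟩ ⟨h3, h4⟩
    exact ⟨fun S ξ i x hx => add_mem (h1 S ξ i x hx) (h3 S ξ i x hx), fun S T e ξ x => by
      simp [h2 S T e ξ x, h4 S T e ξ x]⟩
  zero_mem' := ⟨fun S ξ i x _ => by simp, fun S T e ξ x => by simp⟩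
  smul_mem' := by
    rintro c φ ⟨h1, h2⟩
    exact ⟨fun S ξ i x hx => Submodule.smul_mem _ c (h1 S ξ i x hx), fun S T e ξ x => by
      simp [h2 S T e ξ x]⟩

/-- `F_m Conv(P, O)` in degree `p`: the elements of `Conv(P, O)` of degree `p` that vanish on
`F (m - 1)` (for `m ≥ 1`). -/
def convFil {P : DGPseudoCooperad.{u, w, v₁} K Ξ} (F : P.Filtration) (O : DGOperad.{u, w, v} K Ξ)
    (m : ℕ) (p : ℤ) : Submodule K (Families P O) :=
  conv P O p ⊓
    { carrier := {φ | ∀ S ξ, ∀ x ∈ F.F (m - 1) S ξ, φ S ξ x = 0}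
      add_mem' := by
        intro φ ψ h1 h2 S ξ x hx
        simp [h1 S ξ x hx, h2 S ξ x hx]
      zero_mem' := by
        intro S ξ x hx
        simp
      smul_mem' := by
        intro c φ h1 S ξ x hx
        simp [h1 S ξ x hx] }

/-- The differential `φ ↦ ∂_O ∘ φ - (-1) ^ p φ ∘ ∂_P` on elements `φ` of degree `p`. -/
def convD (P : DGPseudoCooperad.{u, w, v₁} K Ξ) (O : DGOperad.{u, w, v} K Ξ) (p : ℤ) :
    Families P O →ₗ[K] Families P O where
  toFun φ := fun S ξ => O.d S ξ ∘ₗ φ S ξ - p.negOnePow • (φ S ξ ∘ₗ P.d S ξ)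
  map_add' φ ψ := by
    funext S ξ
    ext x
    simp only [Pi.add_apply, LinearMap.sub_apply, LinearMap.comp_apply, LinearMap.add_apply,
      LinearMap.smul_apply, map_add, smul_add]
    abel
  map_smul' c φ := by
    funext S ξ
    ext x
    simp only [Pi.smul_apply, LinearMap.sub_apply, LinearMap.comp_apply, LinearMap.smul_apply,
      map_smul, smul_sub, RingHom.id_apply, smul_comm c p.negOnePow]

/-- The contribution `μ_t ∘ (φ ⊗ ψ) ∘ Δ_t` of the tree `t` with two vertices, given by the subset
`T` of the leaves and the colour `η` of the inner edge. Here `ψ` has degree `q`, and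
`(φ ⊗ ψ)(x ⊗ y) = (-1) ^ (q * |x|) φ(x) ⊗ ψ(y)`. -/
noncomputable def treeTerm (P : DGPseudoCooperad.{u, w, v₁} K Ξ) (O : DGOperad.{u, w, v} K Ξ)
    (q : ℤ) (φ ψ : Families P O) (R : CSet Ξ) (ξ : Ξ) (T : Set R.carrier) (η : Ξ) :
    P.obj R ξ →ₗ[K] O.obj R ξ :=
  O.act (R.join T η) ξ ∘ₗ
    TensorProduct.lift (O.comp (S := R.quot T η) none (R.sub T) (η := η) rfl ξ) ∘ₗ
    TensorProduct.map
      (φ (R.quot T η) ξ ∘ₗ signTwist (P.gr (R.quot T η) ξ) (P.internal (R.quot T η) ξ) q)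
      (ψ (R.sub T) η) ∘ₗ
    P.comul (S := R.quot T η) none (R.sub T) (η := η) rfl ξ ∘ₗ
    P.act (R.join T η).symm ξ

theorem treeTerm_finite (P : DGPseudoCooperad.{u, w, v₁} K Ξ) (O : DGOperad.{u, w, v} K Ξ)
    (q : ℤ) (φ ψ : Families P O) (R : CSet Ξ) (ξ : Ξ) (x : P.obj R ξ) :
    (Function.support fun t : Set R.carrier × Ξ =>
      treeTerm P O q φ ψ R ξ t.1 t.2 x).Finite := by
  refine (P.comul_finite R ξ x).subset fun t ht h0 => ht ?_
  simp only [treeTerm, LinearMap.comp_apply]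
  rw [h0]
  simp

/-- The pre-Lie product `φ • ψ = ∑_t μ_t ∘ (φ ⊗ ψ) ∘ Δ_t` for `ψ` of degree `q`, where the sum is
over the isomorphism classes of trees with two vertices (on each vector it is a finite sum). -/
noncomputable def preLie (P : DGPseudoCooperad.{u, w, v₁} K Ξ) (O : DGOperad.{u, w, v} K Ξ)
    (q : ℤ) (φ ψ : Families P O) : Families P O := fun R ξ =>
  { toFun := fun x => ∑ᶠ t : Set R.carrier × Ξ, treeTerm P O q φ ψ R ξ t.1 t.2 x
    map_add' := fun x y => by
      rw [← finsum_add_distrib (treeTerm_finite P O q φ ψ R ξ x) (treeTerm_finite P O q φ ψ R ξ y)]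
      simp
    map_smul' := fun c x => by
      rw [RingHom.id_apply, smul_finsum' c (treeTerm_finite P O q φ ψ R ξ x)]
      simp }

/-- The Lie bracket `[φ, ψ] = φ • ψ - (-1) ^ (p * q) ψ • φ` of elements `φ`, `ψ` of degrees
`p`, `q`. -/
noncomputable def convBracket (P : DGPseudoCooperad.{u, w, v₁} K Ξ) (O : DGOperad.{u, w, v} K Ξ)
    (p q : ℤ) (φ ψ : Families P O) : Families P O :=
  preLie P O q φ ψ - (p * q).negOnePow • preLie P O p ψ φ

/-- `f_* : Conv(P, A) → Conv(P, B)`, `φ ↦ f ∘ φ`. -/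
def pushforward (P : DGPseudoCooperad.{u, w, v₁} K Ξ) {A : DGOperad.{u, w, v₂} K Ξ}
    {B : DGOperad.{u, w, v₃} K Ξ} (f : A.Hom B) : Families P A →ₗ[K] Families P B where
  toFun φ := fun S ξ => f.app S ξ ∘ₗ φ S ξ
  map_add' φ ψ := by
    funext S ξ
    ext x
    simp
  map_smul' c φ := by
    funext S ξ
    ext x
    simp

end Conv

end ConvOperad

/-! The differential of the convolution complex, unlike the bracket, sees only the collection
underlying the target operad. So it suffices to invert `f` up to homotopy as a map of dg
collections; the inverse need not be multiplicative.

For each `S` and `ξ` the component of `f` is a quasi-isomorphism of complexes of vector spaces. Its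
cone is exact, hence contractible, and the entries of a contraction give a chain map `g` back and
homotopies `t`, `u` for the two composites (`IsQuasiIso.exists_homotopyInverse`). These data depend
on choices and need not be equivariant. Averaging over the finite set of isomorphisms from `S` to a
chosen representative of its class makes them natural in `S`; characteristic zero allows the
division, and the identities survive because `f` and the differentials are already equivariant
(`DGOperad.Hom.IsQuasiIso.exists_homotopyInverse`).

Postcomposition with `g`, `t`, `u` then makes `f_*` a homotopy equivalence. It respects every `F_m`,
because `F_m` is a vanishing condition on the source, which postcomposition preserves
(`postcomp_mem_convFil`, `isQuasiIso_pushforward`). No spectral sequence or completeness argument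
enters.

The bracket is handled tree by tree. Degrees, relabelling, vanishing on the filtration and
compatibility with `f` are checked for a single grafting (`graftTerm_mem`, `graftTerm_act`,
`graftTerm_eq_zero`, `app_graftTerm`) and then summed. -/

namespace ConvOperad

/-! ### Linear maps on graded spaces and on graded or filtered tensor products -/

section Graded

variable {K : Type*} [Field K]
variable {M : Type*} [AddCommGroup M] [Module K M] {N : Type*} [AddCommGroup N] [Module K N]

/-- Membership in a submodule of the values of a linear map on `∑ G i ⊗ H j` can be tested on
pure tensors. -/
theorem map_mem_of_mem_tensorSum {L : Type*} [AddCommGroup L] [Module K L]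
    {ι : Type*} [Add ι] {G : ι → Submodule K M} {H : ι → Submodule K N} {k : ι}
    (f : M ⊗[K] N →ₗ[K] L) (W : Submodule K L)
    (hf : ∀ i j, i + j = k → ∀ a ∈ G i, ∀ b ∈ H j, f (a ⊗ₜ b) ∈ W)
    {z : M ⊗[K] N} (hz : z ∈ tensorSum G H k) : f z ∈ W := by
  suffices h : tensorSum G H k ≤ W.comap f from h hz
  refine iSup₂_le fun p hp => ?_
  rintro _ ⟨y, rfl⟩
  induction y using TensorProduct.induction_on with
  | zero => simp
  | tmul a b => exact hf p.1 p.2 hp a a.2 b b.2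
  | add y y' hy hy' => rw [map_add]; exact add_mem hy hy'

/-- Linear maps out of a graded vector space are determined by their values on homogeneous
elements. -/
theorem linearMap_ext_of_isInternal {G : ℤ → Submodule K M} (hG : DirectSum.IsInternal G)
    {f g : M →ₗ[K] N} (h : ∀ i, ∀ x ∈ G i, f x = g x) : f = g := by
  have h' : ⨆ i, G i ≤ LinearMap.eqLocus f g := iSup_le fun i x hx => h i x hx
  rw [hG.submodule_iSup_eq_top] at h'
  ext x
  exact h' (Submodule.mem_top (x := x))

/-- Linear maps given degree by degree assemble to a linear map. -/
theorem exists_linearMap_of_isInternal {G : ℤ → Submodule K M} (hG : DirectSum.IsInternal G)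
    (f : ℤ → M →ₗ[K] N) : ∃ g : M →ₗ[K] N, ∀ i, ∀ x ∈ G i, g x = f i x := by
  refine ⟨(DirectSum.toModule K ℤ N fun i => f i ∘ₗ (G i).subtype) ∘ₗ
    (LinearEquiv.ofBijective (DirectSum.coeLinearMap G) hG).symm.toLinearMap, fun i x hx => ?_⟩
  have h : (LinearEquiv.ofBijective (DirectSum.coeLinearMap G) hG).symm x
      = DirectSum.lof K ℤ (fun i => G i) i ⟨x, hx⟩ := by
    rw [LinearEquiv.symm_apply_eq]
    exact (DirectSum.coeLinearMap_lof G i ⟨x, hx⟩).symm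
  simp [h, DirectSum.toModule_lof]

theorem signTwist_mem {G : ℤ → Submodule K M} (hG : DirectSum.IsInternal G) (q i : ℤ) {x : M}
    (hx : x ∈ G i) : signTwist G hG q x ∈ G i := by
  rw [signTwist_of_mem G hG q i hx]
  -- The sign is a unit of `ℤ`, not an element of `K`; splitting into `1` and `-1` replaces
  -- linearity arguments, here and below.
  rcases Int.units_eq_one_or (q * i).negOnePow with h | h <;> simp [h, hx]

theorem map_signTwist {G : ℤ → Submodule K M} (hG : DirectSum.IsInternal G)
    {H : ℤ → Submodule K N} (hH : DirectSum.IsInternal H) (q : ℤ) (f : M →ₗ[K] N)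
    (hf : ∀ i, ∀ x ∈ G i, f x ∈ H i) (x : M) :
    f (signTwist G hG q x) = signTwist H hH q (f x) := by
  have h : f ∘ₗ signTwist G hG q = signTwist H hH q ∘ₗ f := by
    refine linearMap_ext_of_isInternal hG fun i x hx => ?_
    simp only [LinearMap.comp_apply]
    rw [signTwist_of_mem G hG q i hx, signTwist_of_mem H hH q i (hf i x hx)]
    rcases Int.units_eq_one_or (q * i).negOnePow with h | h <;> simp [h]
  exact LinearMap.congr_fun h x

end Graded

/-! ## Contractions over a field -/

section Contraction

variable {K : Type*} [Field K]
variable {M : Type*} [AddCommGroup M] [Module K M] {N : Type*} [AddCommGroup N] [Module K N]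

/-- A linear map over a field has a generalized inverse. -/
theorem exists_linearMap_section (f : M →ₗ[K] N) :
    ∃ s : N →ₗ[K] M, ∀ x, f (s (f x)) = f x := by
  obtain ⟨g, hg⟩ := f.rangeRestrict.exists_rightInverse_of_surjective f.range_rangeRestrict
  obtain ⟨s, hs⟩ := g.exists_extend
  refine ⟨s, fun x => ?_⟩
  have h1 : s (f x) = g (f.rangeRestrict x) := LinearMap.congr_fun hs (f.rangeRestrict x)
  have h2 := congrArg Subtype.val (LinearMap.congr_fun hg (f.rangeRestrict x))
  rw [h1]
  simpa using h2

/-- An exact complex of vector spaces is contractible. -/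
theorem exists_contraction {C : ℤ → Submodule K M} {D : M →ₗ[K] M}
    (hDD : ∀ x, D (D x) = 0)
    (hC : ∀ i, ∀ x ∈ C i, D x = 0 → ∃ y ∈ C (i - 1), D y = x) :
    ∃ h : ℤ → M →ₗ[K] M, (∀ i, ∀ x ∈ C i, h i x ∈ C (i - 1)) ∧
      ∀ i, ∀ x ∈ C i, D (h i x) + h (i + 1) (D x) = x := by
  choose s hs using fun i => exists_linearMap_section (D ∘ₗ (C (i - 1)).subtype)
  have hs' : ∀ i, ∀ y ∈ C (i - 1), D (s i (D y)) = D y := fun i y hy => hs i ⟨y, hy⟩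
  let r : ℤ → M →ₗ[K] M := fun i => (C (i - 1)).subtype ∘ₗ s i
  have hr : ∀ i x, r i x ∈ C (i - 1) := fun i x => (s i x).2
  have hr' : ∀ i, ∀ y ∈ C (i - 1), D (r i (D y)) = D y := hs'
  have hr'' : ∀ i, ∀ y ∈ C i, D (r (i + 1) (D y)) = D y := fun i y hy =>
    hr' (i + 1) y (by rwa [add_sub_cancel_right])
  -- On `C i` the operator is `x ↦ r i (x - r (i + 1) (D x))`. The argument of `r i` is a cocycle,
  -- hence a boundary, so `D ∘ r i` fixes it; on `D x` the correction term dies because `D ∘ D = 0`.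
  refine ⟨fun i => r i - r i ∘ₗ r (i + 1) ∘ₗ D, fun i x _ => sub_mem (hr _ _) (hr _ _),
    fun i x hx => ?_⟩
  have hm : x - r (i + 1) (D x) ∈ C i := by
    refine sub_mem hx ?_
    have := hr (i + 1) (D x)
    rwa [add_sub_cancel_right] at this
  obtain ⟨y, hy, hyx⟩ := hC i _ hm (by rw [map_sub, hr'' i x hx, sub_self])
  have h1 := hr' i y hy
  rw [hyx] at h1
  simp only [LinearMap.sub_apply, LinearMap.comp_apply, hDD, map_zero, sub_zero]
  rw [← map_sub, h1, sub_add_cancel]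

/-- A quasi-isomorphism of complexes of vector spaces is a homotopy equivalence. -/
theorem IsQuasiIso.exists_homotopyInverse {G : ℤ → Submodule K M} (hG : DirectSum.IsInternal G)
    {d : M →ₗ[K] M} (hd : ∀ x, d (d x) = 0)
    {H : ℤ → Submodule K N} (hH : DirectSum.IsInternal H)
    {d' : N →ₗ[K] N} (hd' : ∀ x, d' (d' x) = 0) {f : M →ₗ[K] N}
    (hf : IsQuasiIso G (fun _ => d) H (fun _ => d') f) :
    ∃ (g : N →ₗ[K] M) (t : N →ₗ[K] N) (u : M →ₗ[K] M),
      (∀ i, ∀ y ∈ H i, g y ∈ G i) ∧ (∀ i, ∀ y ∈ H i, t y ∈ H (i - 1)) ∧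
      (∀ i, ∀ x ∈ G i, u x ∈ G (i - 1)) ∧ (∀ y, g (d' y) = d (g y)) ∧
      (∀ y, f (g y) + d' (t y) + t (d' y) = y) ∧ ∀ x, g (f x) - d (u x) - u (d x) = x := by
  obtain ⟨hGc, hHc, hfc, hbij⟩ := hf
  have hcomm : ∀ x, f (d x) = d' (f x) := fun x => LinearMap.congr_fun
    (linearMap_ext_of_isInternal hG (f := f ∘ₗ d) (g := d' ∘ₗ f) hfc.comm) x
  -- The mapping cone of `f`, with `G (i + 1) × H i` in degree `i`.
  let D : M × N →ₗ[K] M × N := (-(d ∘ₗ LinearMap.fst K M N)).prod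
    (f ∘ₗ LinearMap.fst K M N + d' ∘ₗ LinearMap.snd K M N)
  let C : ℤ → Submodule K (M × N) := fun i => (G (i + 1)).prod (H i)
  have hexact : ∀ i, ∀ z ∈ C i, D z = 0 → ∃ y ∈ C (i - 1), D y = z := by
    rintro i ⟨a, b⟩ ⟨ha, hb⟩ hz
    have hz1 : d a = 0 := by simpa [D] using congrArg Prod.fst hz
    have hz2 : f a + d' b = 0 := congrArg Prod.snd hz
    -- The relation `f a = d' (-b)` says that `f` kills the class of `a`, so injectivity on
    -- cohomology applies.
    have h1 : ∃ a' ∈ G i, d a' = a := by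
      have hac : a ∈ cocycles G (fun _ => d) (i + 1) := ⟨ha, hz1⟩
      have h0 : cohomologyMap hfc (i + 1) (Submodule.Quotient.mk ⟨a, hac⟩) = 0 := by
        refine (Submodule.Quotient.mk_eq_zero _).2 ?_
        refine ⟨-b, neg_mem ?_, ?_⟩
        · simpa using hb
        · rw [map_neg]
          exact neg_eq_of_add_eq_zero_left hz2
      have h0' := (hbij (i + 1)).1 (h0.trans (map_zero _).symm)
      obtain ⟨a', ha', h⟩ := (Submodule.Quotient.mk_eq_zero _).1 h0'
      exact ⟨a', by simpa using ha', h⟩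
    obtain ⟨a', ha', rfl⟩ := h1
    have hbc : b + f a' ∈ cocycles H (fun _ => d') i :=
      ⟨add_mem hb (hfc.map_mem i a' ha'), by
        change d' (b + f a') = 0
        rw [map_add, ← hcomm, add_comm, hz2]⟩
    obtain ⟨ω, hω⟩ := (hbij i).2 (Submodule.Quotient.mk ⟨_, hbc⟩)
    obtain ⟨⟨c, hc⟩, rfl⟩ := Submodule.Quotient.mk_surjective _ ω
    obtain ⟨b', hb', h⟩ := (Submodule.Quotient.eq _).1 hω
    have h : d' b' = f c - (b + f a') := h
    have hdc : d c = 0 := hc.2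
    -- Surjectivity corrects the cocycle `b + f a'` to `f c` modulo `d' b'`; since `d c = 0`,
    -- subtracting `a'` from `c` leaves the first component of `D` equal to `d a'`.
    refine ⟨(c - a', -b'), ⟨?_, neg_mem hb'⟩, ?_⟩
    · rw [sub_add_cancel]
      exact sub_mem hc.1 ha'
    · refine Prod.ext ?_ ?_
      · simp [D, hdc]
      · simp [D, h]
  obtain ⟨h, hh, hh'⟩ := exists_contraction (C := C) (D := D)
    (by
      rintro ⟨a, b⟩
      refine Prod.ext ?_ ?_ <;> simp [D, hd, hd', hcomm])
    hexact
  -- Three of the four matrix entries of the contraction are used. The identity `D h + h D = 1` on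
  -- `(0, y)` yields that `g` is a chain map and the formula for `f g`; its first component on `(x,
  -- 0)` yields the formula for `g f`, with the signs of `u` coming from the `-d` in the cone.
  obtain ⟨g, hg⟩ := exists_linearMap_of_isInternal hH
    fun i => LinearMap.fst K M N ∘ₗ h i ∘ₗ LinearMap.inr K M N
  obtain ⟨t, ht⟩ := exists_linearMap_of_isInternal hH
    fun i => LinearMap.snd K M N ∘ₗ h i ∘ₗ LinearMap.inr K M N
  obtain ⟨u, hu⟩ := exists_linearMap_of_isInternal hG
    fun i => LinearMap.fst K M N ∘ₗ h (i - 1) ∘ₗ LinearMap.inl K M N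
  have hinr : ∀ i, ∀ y ∈ H i, ((0, y) : M × N) ∈ C i := fun i y hy => ⟨zero_mem _, hy⟩
  -- The shift in the cone places `G i` in degree `i - 1`, which is why `u` is built from `h (i -
  -- 1)`.
  have hinl : ∀ i, ∀ x ∈ G i, ((x, 0) : M × N) ∈ C (i - 1) := fun i x hx =>
    ⟨by simpa using hx, zero_mem _⟩
  have hDr : ∀ y, D (0, y) = (0, d' y) := fun y => by simp [D]
  have hDl : ∀ x, D (x, 0) = -(d x, 0) + (0, f x) := fun x => by simp [D]
  have hb : ∀ i, ∀ y ∈ H i, D (g y, t y) + (g (d' y), t (d' y)) = (0, y) := by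
    intro i y hy
    have := hh' i _ (hinr i y hy)
    rw [hDr] at this
    rw [hg i y hy, ht i y hy, hg _ _ (hHc.d_mem i y hy), ht _ _ (hHc.d_mem i y hy)]
    exact this
  refine ⟨g, t, u, fun i y hy => ?_, fun i y hy => ?_, fun i x hx => ?_, fun y => ?_, fun y => ?_,
    fun x => ?_⟩
  · rw [hg i y hy]
    simpa using (hh i _ (hinr i y hy)).1
  · rw [ht i y hy]
    exact (hh i _ (hinr i y hy)).2
  · rw [hu i x hx]
    simpa using (hh (i - 1) _ (hinl i x hx)).1
  · refine LinearMap.congr_fun (linearMap_ext_of_isInternal hH (f := g ∘ₗ d') (g := d ∘ₗ g)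
      fun i y hy => ?_) y
    have := congrArg Prod.fst (hb i y hy)
    exact (neg_add_eq_zero.1 this).symm
  · refine LinearMap.congr_fun (linearMap_ext_of_isInternal hH
      (f := f ∘ₗ g + d' ∘ₗ t + t ∘ₗ d') (g := LinearMap.id) fun i y hy => ?_) y
    exact congrArg Prod.snd (hb i y hy)
  · refine LinearMap.congr_fun (linearMap_ext_of_isInternal hG
      (f := g ∘ₗ f - d ∘ₗ u - u ∘ₗ d) (g := LinearMap.id) fun i x hx => ?_) x
    have h1 := congrArg Prod.fst (hh' _ _ (hinl i x hx))
    rw [hDl, sub_add_cancel, map_add, map_neg] at h1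
    have h2 := hu (i + 1) _ (hGc.d_mem i x hx)
    rw [add_sub_cancel_right] at h2
    simp only [LinearMap.sub_apply, LinearMap.comp_apply, LinearMap.id_apply, h2, hu i x hx,
      hg i _ (hfc.map_mem i x hx), LinearMap.fst_apply, LinearMap.inl_apply, LinearMap.inr_apply]
    have h3 : -(d (h (i - 1) (x, 0)).1) + (-(h i (d x, 0)).1 + (h i (0, f x)).1) = x := h1
    exact Eq.trans (by abel) h3

end Contraction

/-! ## Relabelling of trees with two vertices -/

namespace CIso

variable {Ξ : Type*} {S T U : CSet Ξ}

@[ext]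
theorem ext {e e' : CIso S T} (h : ∀ s, e.toEquiv s = e'.toEquiv s) : e = e' := by
  cases e
  cases e'
  congr
  exact Equiv.ext h

theorem symm_trans_self (e : CIso S T) : e.symm.trans e = refl T :=
  ext fun t => e.toEquiv.apply_symm_apply t

theorem self_trans_symm (e : CIso S T) : e.trans e.symm = refl S :=
  ext fun s => e.toEquiv.symm_apply_apply s

instance : Finite (CIso S T) :=
  Finite.of_injective CIso.toEquiv fun e e' h => ext fun s => by rw [h]

/-- Precomposition with an isomorphism. -/
def precomp (g : CIso S T) (U : CSet Ξ) : CIso T U ≃ CIso S U where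
  toFun e := g.trans e
  invFun e := g.symm.trans e
  left_inv e := ext fun t => congrArg e.toEquiv (g.toEquiv.apply_symm_apply t)
  right_inv e := ext fun s => congrArg e.toEquiv (g.toEquiv.symm_apply_apply s)

/-- The isomorphism induced on subsets. -/
def subMap (e : CIso S T) (X : Set T.carrier) : CIso (S.sub (e.toEquiv ⁻¹' X)) (T.sub X) where
  toEquiv := e.toEquiv.subtypeEquiv fun _ => Iff.rfl
  color_eq s := e.color_eq s.1

/-- The isomorphism induced on quotients. -/
def quotMap (e : CIso S T) (X : Set T.carrier) (η : Ξ) :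
    CIso (S.quot (e.toEquiv ⁻¹' X) η) (T.quot X η) where
  toEquiv := Equiv.optionCongr (e.toEquiv.subtypeEquiv fun _ => Iff.rfl)
  color_eq s := by
    rcases s with _ | s
    · rfl
    · exact e.color_eq s.1

/-- Naturality of the description of two-vertex trees by subsets of the leaves; it supplies the
compatibility condition needed in `graftTerm_act`. -/
theorem insMap_trans_join (e : CIso S T) (X : Set T.carrier) (η : Ξ) :
    (CSet.insMap (e.quotMap X η) none (e.subMap X)).trans (T.join X η) =
      (S.join (e.toEquiv ⁻¹' X) η).trans e := by
  refine ext ?_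
  rintro (⟨_ | x, h⟩ | x)
  · exact absurd rfl h
  · rfl
  · rfl

end CIso

namespace DGCollection

variable {K : Type*} [Field K] {Ξ : Type*} (A : DGCollection K Ξ)

theorem act_act_symm {S T : CSet Ξ} (e : CIso S T) (ξ : Ξ) (x : A.obj T ξ) :
    A.act e ξ (A.act e.symm ξ x) = x := by
  rw [← A.act_trans, e.symm_trans_self, A.act_refl]

theorem act_symm_act {S T : CSet Ξ} (e : CIso S T) (ξ : Ξ) (x : A.obj S ξ) :
    A.act e.symm ξ (A.act e ξ x) = x := by
  rw [← A.act_trans, e.self_trans_symm, A.act_refl]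

end DGCollection

/-! ## The convolution Lie algebra -/

section Conv

variable {K : Type*} [Field K] {Ξ : Type*} {P : DGPseudoCooperad K Ξ}

/-- The map `μ ∘ (φ ⊗ ψ) ∘ Δ` for the tree obtained by grafting the corolla with inputs `T` into the
input `s` of the corolla with inputs `S`, with leaves labelled by `R` by means of `j`. -/
noncomputable def graftTerm (P : DGPseudoCooperad K Ξ) (O : DGOperad K Ξ) (q : ℤ)
    (φ ψ : Families P O) (ξ : Ξ) {S : CSet Ξ} (s : S.carrier) (T : CSet Ξ) {η : Ξ}
    (h : S.color s = η) {R : CSet Ξ} (j : CIso (S.ins s T) R) : P.obj R ξ →ₗ[K] O.obj R ξ :=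
  O.act j ξ ∘ₗ TensorProduct.lift (O.comp s T h ξ) ∘ₗ
    TensorProduct.map (φ S ξ ∘ₗ signTwist (P.gr S ξ) (P.internal S ξ) q) (ψ T η) ∘ₗ
    P.comul s T h ξ ∘ₗ P.act j.symm ξ

theorem graftTerm_mem {O : DGOperad K Ξ} {p q : ℤ} {φ ψ : Families P O}
    (hφ : φ ∈ conv P O p) (hψ : ψ ∈ conv P O q) (ξ : Ξ) {S : CSet Ξ} (s : S.carrier) (T : CSet Ξ)
    {η : Ξ} (h : S.color s = η) {R : CSet Ξ} (j : CIso (S.ins s T) R)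
    (k : ℤ) {x : P.obj R ξ} (hx : x ∈ P.gr R ξ k) :
    graftTerm P O q φ ψ ξ s T h j x ∈ O.gr R ξ (k + (p + q)) := by
  refine O.act_mem _ _ _ _ ?_
  refine map_mem_of_mem_tensorSum (TensorProduct.lift (O.comp s T h ξ) ∘ₗ TensorProduct.map
    (φ S ξ ∘ₗ signTwist (P.gr S ξ) (P.internal S ξ) q) (ψ T η)) _ ?_
    (P.comul_mem s T h ξ k _ (P.act_mem j.symm ξ k x hx))
  rintro i l rfl a ha b hb
  have := O.comp_mem s T h ξ _ _ _
    (hφ.1 _ _ i _ (signTwist_mem (P.internal _ ξ) q i ha)) _ (hψ.1 _ _ l b hb)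
  rw [add_add_add_comm] at this
  simpa using this

/-- Every ingredient is natural under isomorphisms of the two corollas, including the sign, since
relabelling preserves degrees. The condition `hj` says that the two labellings of the leaves match.
-/
theorem graftTerm_act {O : DGOperad K Ξ} {p q : ℤ} {φ ψ : Families P O}
    (hφ : φ ∈ conv P O p) (hψ : ψ ∈ conv P O q) (ξ : Ξ) {S S' : CSet Ξ} (s : S.carrier)
    {T T' : CSet Ξ} {η : Ξ} (h : S.color s = η) (eS : CIso S S') (eT : CIso T T')
    (h' : S'.color (eS.toEquiv s) = η) {R R' : CSet Ξ} (j : CIso (S.ins s T) R)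
    (j' : CIso (S'.ins (eS.toEquiv s) T') R') (e : CIso R R')
    (hj : (CSet.insMap eS s eT).trans j' = j.trans e) (x : P.obj R ξ) :
    graftTerm P O q φ ψ ξ (eS.toEquiv s) T' h' j' (P.act e ξ x) =
      O.act e ξ (graftTerm P O q φ ψ ξ s T h j x) := by
  -- `comul_act` concerns only relabellings of the form `insMap`, so `x` is first transported to the
  -- leaves `S.ins s T`.
  obtain ⟨y, rfl⟩ : ∃ y, x = P.act j ξ y := ⟨_, (P.act_act_symm _ ξ x).symm⟩
  simp only [graftTerm, LinearMap.comp_apply]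
  rw [P.act_symm_act, ← O.act_trans j, ← P.act_trans j, ← hj, O.act_trans, P.act_trans,
    P.act_symm_act, P.comul_act eS eT s h h']
  refine congrArg (O.act j' ξ) ?_
  generalize P.comul s T h ξ y = z
  induction z using TensorProduct.induction_on with
  | zero => simp only [map_zero]
  | tmul a b =>
    simp only [TensorProduct.map_tmul, TensorProduct.lift.tmul, LinearMap.comp_apply]
    rw [← O.comp_act eS eT s h h' ξ, ← hφ.2, ← hψ.2,
      map_signTwist (P.internal _ ξ) (P.internal _ ξ) q _ (P.act_mem _ ξ)]
  | add z z' hz hz' => simp only [map_add, hz, hz']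

/-- The comultiplication sends `F (m - 1)` into a sum of `F i ⊗ F l` with `i + l = m - 1`. Then `l ≤
m - 1`, so `ψ` already kills the second factor. -/
theorem graftTerm_eq_zero {O : DGOperad K Ξ} (F : P.Filtration) {m : ℕ} {q : ℤ}
    {φ ψ : Families P O} (hψ : ψ ∈ convFil F O m q) (ξ : Ξ) {S : CSet Ξ} (s : S.carrier)
    (T : CSet Ξ) {η : Ξ} (h : S.color s = η) {R : CSet Ξ} (j : CIso (S.ins s T) R)
    {x : P.obj R ξ} (hx : x ∈ F.F (m - 1) R ξ) :
    graftTerm P O q φ ψ ξ s T h j x = 0 := by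
  have h0 := map_mem_of_mem_tensorSum (TensorProduct.map
    (φ S ξ ∘ₗ signTwist (P.gr S ξ) (P.internal S ξ) q) (ψ T η)) ⊥ (fun i l hil a _ b hb => by
      have hb' : b ∈ F.F (m - 1) T η :=
        monotone_nat_of_le_succ (f := fun k => F.F k T η) (fun k => F.mono k _ _) (by omega) hb
      rw [TensorProduct.map_tmul, hψ.2 _ _ b hb', TensorProduct.tmul_zero]
      exact zero_mem _)
    (F.comul_mem (m - 1) s T h ξ _ (F.act_mem _ j.symm ξ x hx))
  simp only [graftTerm, LinearMap.comp_apply]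
  rw [(Submodule.mem_bot K).1 h0, map_zero, map_zero]

theorem treeTerm_act {O : DGOperad K Ξ} {p q : ℤ} {φ ψ : Families P O}
    (hφ : φ ∈ conv P O p) (hψ : ψ ∈ conv P O q) {R R' : CSet Ξ} (e : CIso R R') (ξ : Ξ)
    (T : Set R'.carrier) (η : Ξ) (x : P.obj R ξ) :
    treeTerm P O q φ ψ R' ξ T η (P.act e ξ x) =
      O.act e ξ (treeTerm P O q φ ψ R ξ (e.toEquiv ⁻¹' T) η x) :=
  graftTerm_act hφ hψ ξ (S := R.quot (e.toEquiv ⁻¹' T) η) none rfl (e.quotMap T η) (e.subMap T) rfl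
    (R.join (e.toEquiv ⁻¹' T) η) (R'.join T η) e (e.insMap_trans_join T η) x

theorem preLie_mem_conv {O : DGOperad K Ξ} {p q : ℤ} {φ ψ : Families P O}
    (hφ : φ ∈ conv P O p) (hψ : ψ ∈ conv P O q) : preLie P O q φ ψ ∈ conv P O (p + q) := by
  refine ⟨fun R ξ k x hx => ?_, fun R R' e ξ x => ?_⟩
  · exact finsum_induction (· ∈ O.gr R ξ (k + (p + q))) (zero_mem _)
      (fun _ _ => add_mem) fun t => graftTerm_mem hφ hψ ξ _ _ _ _ k hx
  · change ∑ᶠ t : Set R'.carrier × Ξ, treeTerm P O q φ ψ R' ξ t.1 t.2 (P.act e ξ x) =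
      O.act e ξ (∑ᶠ t : Set R.carrier × Ξ, treeTerm P O q φ ψ R ξ t.1 t.2 x)
    rw [map_finsum (O.act e ξ) (treeTerm_finite P O q φ ψ R ξ x),
      -- Relabelling permutes the trees: a subset of the leaves `R'` corresponds to its preimage in
      -- `R`, and the colour of the inner edge is unchanged.
      ← finsum_comp_equiv ((Equiv.Set.congr e.toEquiv).symm.prodCongr (Equiv.refl Ξ))]
    refine finsum_congr fun t => ?_
    rw [treeTerm_act hφ hψ]
    have : (Equiv.Set.congr e.toEquiv).symm t.1 = e.toEquiv ⁻¹' t.1 :=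
      (e.toEquiv.symm.image_eq_preimage_symm t.1)
    simp [this]

theorem preLie_mem_convFil {O : DGOperad K Ξ} (F : P.Filtration) {m : ℕ} {p q : ℤ}
    {φ ψ : Families P O} (hφ : φ ∈ convFil F O m p) (hψ : ψ ∈ convFil F O m q) :
    preLie P O q φ ψ ∈ convFil F O m (p + q) := by
  refine ⟨preLie_mem_conv hφ.1 hψ.1, fun R ξ x hx => ?_⟩
  exact finsum_eq_zero_of_forall_eq_zero fun t =>
    graftTerm_eq_zero F hψ ξ _ _ _ (R.join t.1 t.2) hx

theorem convBracket_mem_convFil {O : DGOperad K Ξ} (F : P.Filtration) {m : ℕ} {p q : ℤ}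
    {φ ψ : Families P O} (hφ : φ ∈ convFil F O m p) (hψ : ψ ∈ convFil F O m q) :
    convBracket P O p q φ ψ ∈ convFil F O m (p + q) := by
  have h := preLie_mem_convFil F hψ hφ
  rw [add_comm] at h
  refine sub_mem (preLie_mem_convFil F hφ hψ) ?_
  rcases Int.units_eq_one_or (p * q).negOnePow with h' | h' <;> simp [h', h]

variable {A B : DGOperad K Ξ}

/-- The Koszul sign depends only on `q` and on degrees in `P`, so applying the multiplicative and
equivariant `f` introduces no new sign. -/
theorem app_graftTerm (f : A.Hom B) (q : ℤ) (φ ψ : Families P A) (ξ : Ξ) {S : CSet Ξ}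
    (s : S.carrier) (T : CSet Ξ) {η : Ξ} (h : S.color s = η) {R : CSet Ξ}
    (j : CIso (S.ins s T) R) (x : P.obj R ξ) :
    f.app R ξ (graftTerm P A q φ ψ ξ s T h j x) =
      graftTerm P B q (pushforward P f φ) (pushforward P f ψ) ξ s T h j x := by
  simp only [graftTerm, LinearMap.comp_apply, f.app_act]
  refine congrArg (B.act j ξ) ?_
  generalize P.comul s T h ξ _ = z
  induction z using TensorProduct.induction_on with
  | zero => simp only [map_zero]
  | tmul a b =>
    simp only [TensorProduct.map_tmul, TensorProduct.lift.tmul, f.app_comp]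
    rfl
  | add z z' hz hz' => simp only [map_add, hz, hz']

theorem pushforward_preLie (f : A.Hom B) (q : ℤ) (φ ψ : Families P A) :
    pushforward P f (preLie P A q φ ψ) =
      preLie P B q (pushforward P f φ) (pushforward P f ψ) := by
  funext R ξ
  ext x
  change f.app R ξ (∑ᶠ t : Set R.carrier × Ξ, treeTerm P A q φ ψ R ξ t.1 t.2 x) =
    ∑ᶠ t : Set R.carrier × Ξ, treeTerm P B q (pushforward P f φ) (pushforward P f ψ) R ξ t.1 t.2 x
  rw [map_finsum (f.app R ξ) (treeTerm_finite P A q φ ψ R ξ x)]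
  exact finsum_congr fun t => app_graftTerm f q φ ψ ξ _ _ _ (R.join t.1 t.2) x

theorem pushforward_convBracket (f : A.Hom B) (p q : ℤ) (φ ψ : Families P A) :
    pushforward P f (convBracket P A p q φ ψ) =
      convBracket P B p q (pushforward P f φ) (pushforward P f ψ) := by
  simp only [convBracket, map_sub, pushforward_preLie]
  rcases Int.units_eq_one_or (p * q).negOnePow with h | h <;> simp [h, pushforward_preLie]

/-- `F_m Conv(P, O)` is closed under the differential. -/
theorem convD_mem_convFil {O : DGOperad K Ξ} (F : P.Filtration) {m : ℕ} {p : ℤ}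
    {φ : Families P O} (hφ : φ ∈ convFil F O m p) :
    convD P O p φ ∈ convFil F O m (p + 1) := by
  have hs : ∀ {S ξ} (W : Submodule K (O.obj S ξ)) {y}, y ∈ W → p.negOnePow • y ∈ W := by
    intro S ξ W y hy
    rcases Int.units_eq_one_or p.negOnePow with h | h <;> simp [h, hy]
  refine ⟨⟨fun S ξ i x hx => ?_, fun S T e ξ x => ?_⟩, fun S ξ x hx => ?_⟩
  · refine sub_mem ?_ (hs _ ?_)
    · have := O.d_mem _ _ _ _ (hφ.1.1 S ξ i x hx)
      rwa [add_assoc] at this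
    · have := hφ.1.1 S ξ _ _ (P.d_mem S ξ i x hx)
      rwa [add_assoc, add_comm 1 p] at this
  · change O.d T ξ (φ T ξ (P.act e ξ x)) - p.negOnePow • φ T ξ (P.d T ξ (P.act e ξ x)) =
      O.act e ξ (O.d S ξ (φ S ξ x) - p.negOnePow • φ S ξ (P.d S ξ x))
    rw [hφ.1.2, ← O.act_d, ← P.act_d, hφ.1.2, map_sub]
    rcases Int.units_eq_one_or p.negOnePow with h | h <;> simp [h]
  · change O.d S ξ (φ S ξ x) - p.negOnePow • φ S ξ (P.d S ξ x) = 0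
    have hdx : P.d S ξ x ∈ F.F (m - 1) S ξ := by
      -- `d_mem` speaks only of successor levels; at level `0` the filtration is zero. Only
      -- stability of `F (m - 1)` under the differential is needed, not the drop by one.
      obtain h | ⟨k, h⟩ : m - 1 = 0 ∨ ∃ k, m - 1 = k + 1 := by
        rcases m - 1 with _ | k <;> simp
      · rw [h, F.zero, Submodule.mem_bot] at hx
        rw [hx, map_zero]
        exact zero_mem _
      · rw [h] at hx ⊢
        exact F.mono _ _ _ (F.d_mem k S ξ x hx)
    rw [hφ.2 S ξ x hx, hφ.2 S ξ _ hdx, map_zero, smul_zero, sub_zero]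

/-- The two mixed terms `∂_O ∘ φ ∘ ∂_P` cancel because the sign flips from degree `p` to `p + 1`. -/
theorem convD_convD (O : DGOperad K Ξ) (p : ℤ) (φ : Families P O) :
    convD P O (p + 1) (convD P O p φ) = 0 := by
  funext S ξ
  ext x
  change O.d S ξ (O.d S ξ (φ S ξ x) - p.negOnePow • φ S ξ (P.d S ξ x)) -
    (p + 1).negOnePow • (O.d S ξ (φ S ξ (P.d S ξ x)) -
      p.negOnePow • φ S ξ (P.d S ξ (P.d S ξ x))) = 0
  rw [P.d_d, map_sub, O.d_d, Int.negOnePow_succ, map_zero, smul_zero, sub_zero]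
  rcases Int.units_eq_one_or p.negOnePow with h | h <;> simp [h]

theorem isComplex_convFil (F : P.Filtration) (O : DGOperad K Ξ) (m : ℕ) :
    IsComplex (convFil F O m) (convD P O) where
  d_mem _ _ hφ := convD_mem_convFil F hφ
  d_d p φ _ := convD_convD O p φ

end Conv

/-! ## Averaging -/

namespace CSet

variable {Ξ : Type*}

/-- The isomorphism relation on coloured finite sets. -/
def isoSetoid (Ξ : Type*) : Setoid (CSet Ξ) where
  r S T := Nonempty (CIso S T)
  iseqv := ⟨fun S => ⟨CIso.refl S⟩, fun ⟨e⟩ => ⟨e.symm⟩, fun ⟨e⟩ ⟨e'⟩ => ⟨e.trans e'⟩⟩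

/-- A chosen representative of the isomorphism class of a coloured finite set. -/
noncomputable def rep (S : CSet Ξ) : CSet Ξ := (Quotient.mk (isoSetoid Ξ) S).out

/-- An equality of sets rather than an isomorphism: averages over isomorphic `S` and `T` then use
the same map `θ R` and can be compared by rewriting. -/
theorem rep_eq {S T : CSet Ξ} (e : CIso S T) : S.rep = T.rep :=
  congrArg Quotient.out (Quotient.sound (s := isoSetoid Ξ) ⟨e⟩)

instance (S : CSet Ξ) : Nonempty (CIso S S.rep) :=
  (isoSetoid Ξ).symm (Quotient.exact (Quotient.out_eq (Quotient.mk (isoSetoid Ξ) S)))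

end CSet

section Average

variable {K : Type*} [Field K] {Ξ : Type*} {A B : DGCollection K Ξ}

/-- The average of the conjugates of `θ R` under all isomorphisms `S ≅ R`. -/
noncomputable def averageOver (R : CSet Ξ) (θ : ∀ S ξ, A.obj S ξ →ₗ[K] B.obj S ξ) (S : CSet Ξ)
    (ξ : Ξ) : A.obj S ξ →ₗ[K] B.obj S ξ :=
  letI := Fintype.ofFinite (CIso S R)
  (Nat.card (CIso S R) : K)⁻¹ • ∑ e : CIso S R, B.act e.symm ξ ∘ₗ θ R ξ ∘ₗ A.act e ξ

/-- The family of equivariant maps obtained from an arbitrary family by averaging. -/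
noncomputable def average (θ : ∀ S ξ, A.obj S ξ →ₗ[K] B.obj S ξ) (S : CSet Ξ) (ξ : Ξ) :
    A.obj S ξ →ₗ[K] B.obj S ξ :=
  averageOver S.rep θ S ξ

theorem average_apply (θ : ∀ S ξ, A.obj S ξ →ₗ[K] B.obj S ξ) (S : CSet Ξ) (ξ : Ξ)
    [Fintype (CIso S S.rep)] (x : A.obj S ξ) :
    average θ S ξ x = (Nat.card (CIso S S.rep) : K)⁻¹ •
      ∑ e : CIso S S.rep, B.act e.symm ξ (θ S.rep ξ (A.act e ξ x)) := by
  simp only [average, averageOver, LinearMap.smul_apply, LinearMap.sum_apply, LinearMap.comp_apply]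
  congr!

/-- Precomposition with `g` is a bijection between the index sets of the two sums. Summing over
isomorphisms to a fixed `R`, rather than over automorphisms of `S`, gives naturality for all
isomorphisms at once. -/
theorem averageOver_act (R : CSet Ξ) (θ : ∀ S ξ, A.obj S ξ →ₗ[K] B.obj S ξ) {S T : CSet Ξ}
    (g : CIso S T) (ξ : Ξ) (x : A.obj S ξ) :
    averageOver R θ T ξ (A.act g ξ x) = B.act g ξ (averageOver R θ S ξ x) := by
  let := Fintype.ofFinite (CIso S R)
  let := Fintype.ofFinite (CIso T R)
  simp only [averageOver, LinearMap.smul_apply, LinearMap.sum_apply, LinearMap.comp_apply,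
    map_smul, map_sum]
  rw [Nat.card_congr (g.precomp R)]
  refine congrArg _ (Fintype.sum_equiv (g.precomp R) _ _ fun e => ?_)
  change _ = B.act g ξ (B.act (g.trans e).symm ξ (θ R ξ (A.act (g.trans e) ξ x)))
  rw [← B.act_trans _ g, ← A.act_trans]
  congr 2
  exact CIso.ext fun t => (g.toEquiv.apply_symm_apply _).symm

theorem average_act (θ : ∀ S ξ, A.obj S ξ →ₗ[K] B.obj S ξ) {S T : CSet Ξ}
    (g : CIso S T) (ξ : Ξ) (x : A.obj S ξ) :
    average θ T ξ (A.act g ξ x) = B.act g ξ (average θ S ξ x) := by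
  rw [average, average, CSet.rep_eq g, averageOver_act]

theorem average_mem (θ : ∀ S ξ, A.obj S ξ →ₗ[K] B.obj S ξ) (p : ℤ)
    (hθ : ∀ S ξ i, ∀ x ∈ A.gr S ξ i, θ S ξ x ∈ B.gr S ξ (i + p)) (S : CSet Ξ) (ξ : Ξ) (i : ℤ)
    (x : A.obj S ξ) (hx : x ∈ A.gr S ξ i) : average θ S ξ x ∈ B.gr S ξ (i + p) := by
  let := Fintype.ofFinite (CIso S S.rep)
  rw [average_apply]
  exact Submodule.smul_mem _ _ (sum_mem fun e _ =>
    B.act_mem _ _ _ _ (hθ _ _ _ _ (A.act_mem e ξ i x hx)))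

/-- A sum over the isomorphisms from `S` to its representative, all of whose terms are equal. -/
theorem average_const [CharZero K] {V : Type*} [AddCommGroup V] [Module K V] (S : CSet Ξ)
    [Fintype (CIso S S.rep)] (v : V) :
    (Nat.card (CIso S S.rep) : K)⁻¹ • ∑ _e : CIso S S.rep, v = v := by
  -- The number of isomorphisms is positive because `S` is isomorphic to its representative, hence
  -- invertible in characteristic zero.
  rw [Finset.sum_const, Finset.card_univ, ← Nat.card_eq_fintype_card, ← Nat.cast_smul_eq_nsmul K,
    smul_smul, inv_mul_cancel₀ (Nat.cast_ne_zero.2 Nat.card_pos.ne'), one_smul]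

end Average

/-! ### Equivariant homotopy inverses of operad quasi-isomorphisms -/

section Homotopy

variable {K : Type*} [Field K] [CharZero K] {Ξ : Type*} {A B : DGOperad K Ξ}

/-- In characteristic zero, a quasi-isomorphism of dg operads has an equivariant homotopy
inverse. -/
theorem DGOperad.Hom.IsQuasiIso.exists_homotopyInverse {f : A.Hom B} (hf : f.IsQuasiIso) :
    ∃ (g : ∀ S ξ, B.obj S ξ →ₗ[K] A.obj S ξ) (t : ∀ S ξ, B.obj S ξ →ₗ[K] B.obj S ξ)
      (u : ∀ S ξ, A.obj S ξ →ₗ[K] A.obj S ξ),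
      (∀ S ξ i, ∀ y ∈ B.gr S ξ i, g S ξ y ∈ A.gr S ξ (i + 0)) ∧
      (∀ S ξ i, ∀ y ∈ B.gr S ξ i, t S ξ y ∈ B.gr S ξ (i + -1)) ∧
      (∀ S ξ i, ∀ x ∈ A.gr S ξ i, u S ξ x ∈ A.gr S ξ (i + -1)) ∧
      (∀ {S T} (e : CIso S T) ξ y, g T ξ (B.act e ξ y) = A.act e ξ (g S ξ y)) ∧
      (∀ {S T} (e : CIso S T) ξ y, t T ξ (B.act e ξ y) = B.act e ξ (t S ξ y)) ∧
      (∀ {S T} (e : CIso S T) ξ x, u T ξ (A.act e ξ x) = A.act e ξ (u S ξ x)) ∧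
      (∀ S ξ y, g S ξ (B.d S ξ y) = A.d S ξ (g S ξ y)) ∧
      (∀ S ξ y, f.app S ξ (g S ξ y) + B.d S ξ (t S ξ y) + t S ξ (B.d S ξ y) = y) ∧
      (∀ S ξ x, g S ξ (f.app S ξ x) - A.d S ξ (u S ξ x) - u S ξ (A.d S ξ x) = x) := by
  choose g t u hg ht hu hgd hfg hgf using fun S ξ => (hf S ξ).exists_homotopyInverse
    (A.internal S ξ) (A.d_d S ξ) (B.internal S ξ) (B.d_d S ξ)
  refine ⟨average g, average t, average u, average_mem g 0 (by simpa using hg), average_mem t (-1) ht,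
    average_mem u (-1) hu, average_act g, average_act t, average_act u,
    fun S ξ y => ?_, fun S ξ y => ?_, fun S ξ x => ?_⟩ <;>
    let := Fintype.ofFinite (CIso S S.rep)
  · simp only [average_apply, map_smul, map_sum, B.act_d, hgd, A.act_d]
  -- Since `f.app` and `B.d` commute with relabelling, each summand is the homotopy identity at
  -- `S.rep` conjugated by `e`, so it equals `y`.
  · refine Eq.trans ?_ (average_const (K := K) S y)
    simp only [average_apply, map_smul, map_sum, ← smul_add, ← Finset.sum_add_distrib]
    refine congrArg _ (Finset.sum_congr rfl fun e _ => ?_)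
    rw [f.app_act, ← B.act_d, B.act_d e, ← map_add, ← map_add, hfg, B.act_symm_act]
  · refine Eq.trans ?_ (average_const (K := K) S x)
    simp only [average_apply, map_smul, map_sum, ← smul_sub, ← Finset.sum_sub_distrib]
    refine congrArg _ (Finset.sum_congr rfl fun e _ => ?_)
    rw [← f.app_act, ← A.act_d, A.act_d e, ← map_sub, ← map_sub, hgf, A.act_symm_act]

end Homotopy

/-! ### Postcomposition on the convolution complex and the quasi-isomorphism -/

section QuasiIso

variable {K : Type*} [Field K] {Ξ : Type*} {P : DGPseudoCooperad K Ξ} {A B : DGOperad K Ξ}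

/-- Composition with a family of linear maps. -/
def postcomp (P : DGPseudoCooperad K Ξ) (θ : ∀ S ξ, A.obj S ξ →ₗ[K] B.obj S ξ)
    (φ : Families P A) : Families P B := fun S ξ => θ S ξ ∘ₗ φ S ξ

theorem postcomp_zero (θ : ∀ S ξ, A.obj S ξ →ₗ[K] B.obj S ξ) :
    postcomp P θ (0 : Families P A) = 0 := by
  funext S ξ
  exact LinearMap.comp_zero _

/-- No compatibility of `θ` with operadic composition or with the differential is required, so this
covers `g` and the homotopies as well as `f`. -/
theorem postcomp_mem_convFil (F : P.Filtration) {m : ℕ} {θ : ∀ S ξ, A.obj S ξ →ₗ[K] B.obj S ξ}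
    {p : ℤ} (q : ℤ) (hθ : ∀ S ξ i, ∀ x ∈ A.gr S ξ i, θ S ξ x ∈ B.gr S ξ (i + q))
    (hθ' : ∀ {S T} (e : CIso S T) ξ x, θ T ξ (A.act e ξ x) = B.act e ξ (θ S ξ x))
    {φ : Families P A} (hφ : φ ∈ convFil F A m p) : postcomp P θ φ ∈ convFil F B m (p + q) := by
  refine ⟨⟨fun S ξ i x hx => ?_, fun S T e ξ x => ?_⟩, fun S ξ x hx => ?_⟩
  · rw [← add_assoc]
    exact hθ _ _ _ _ (hφ.1.1 S ξ i x hx)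
  · change θ T ξ (φ T ξ _) = B.act e ξ (θ S ξ (φ S ξ x))
    rw [hφ.1.2, hθ']
  · change θ S ξ (φ S ξ x) = 0
    rw [hφ.2 S ξ x hx, map_zero]

theorem convD_postcomp (p : ℤ) {θ : ∀ S ξ, A.obj S ξ →ₗ[K] B.obj S ξ}
    (hθ : ∀ S ξ x, θ S ξ (A.d S ξ x) = B.d S ξ (θ S ξ x)) (φ : Families P A) :
    postcomp P θ (convD P A p φ) = convD P B p (postcomp P θ φ) := by
  funext S ξ
  ext x
  change θ S ξ (A.d S ξ (φ S ξ x) - p.negOnePow • φ S ξ (P.d S ξ x)) =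
    B.d S ξ (θ S ξ (φ S ξ x)) - p.negOnePow • θ S ξ (φ S ξ (P.d S ξ x))
  rw [map_sub, hθ]
  rcases Int.units_eq_one_or p.negOnePow with h | h <;> simp [h]

/-- The homotopy formula for composition with a family of maps of degree `-1`. -/
theorem convD_postcomp_add_postcomp_convD (p : ℤ) (θ : ∀ S ξ, A.obj S ξ →ₗ[K] A.obj S ξ)
    (φ : Families P A) :
    convD P A (p - 1) (postcomp P θ φ) + postcomp P θ (convD P A p φ) =
      postcomp P (fun S ξ => A.d S ξ ∘ₗ θ S ξ + θ S ξ ∘ₗ A.d S ξ) φ := by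
  funext S ξ
  ext x
  change A.d S ξ (θ S ξ (φ S ξ x)) - (p - 1).negOnePow • θ S ξ (φ S ξ (P.d S ξ x)) +
    θ S ξ (A.d S ξ (φ S ξ x) - p.negOnePow • φ S ξ (P.d S ξ x)) =
    A.d S ξ (θ S ξ (φ S ξ x)) + θ S ξ (A.d S ξ (φ S ξ x))
  -- The opposite signs in degrees `p - 1` and `p` cancel the terms involving `P.d`.
  have hp : (p - 1).negOnePow = -p.negOnePow := by
    rw [Int.negOnePow_sub, Int.negOnePow_one, mul_neg_one]
  rw [map_sub, hp]
  rcases Int.units_eq_one_or p.negOnePow with h | h <;> simp [h]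

theorem isCochainMap_pushforward (F : P.Filtration) (m : ℕ) (f : A.Hom B) :
    IsCochainMap (convFil F A m) (convD P A) (convFil F B m) (convD P B) (pushforward P f) where
  map_mem p φ hφ := by
    have := postcomp_mem_convFil F 0 (θ := f.app) (by simpa using f.app_mem) f.app_act hφ
    rwa [add_zero] at this
  comm p φ _ := convD_postcomp p f.app_d φ

theorem isQuasiIso_pushforward [CharZero K] (F : P.Filtration) (m : ℕ) {f : A.Hom B}
    (hf : f.IsQuasiIso) :
    IsQuasiIso (convFil F A m) (convD P A) (convFil F B m) (convD P B) (pushforward P f) := by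
  refine ⟨isComplex_convFil F A m, isComplex_convFil F B m, isCochainMap_pushforward F m f,
    fun p => ⟨?_, ?_⟩⟩
  all_goals
    obtain ⟨g, t, u, hg, ht, hu, hge, hte, hue, hgd, hfg, hgf⟩ := hf.exists_homotopyInverse
  · rw [injective_iff_map_eq_zero]
    intro ω hω
    obtain ⟨⟨α, hα, hdα⟩, rfl⟩ := Submodule.Quotient.mk_surjective _ ω
    obtain ⟨β, hβ, hβα⟩ := (Submodule.Quotient.mk_eq_zero _).1 hω
    have hβα : convD P B (p - 1) β = pushforward P f α := hβα
    have hdα : convD P A p α = 0 := hdα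
    -- With `f α = ∂β` and `∂α = 0`, the formula for `g f` gives `α = g f α - ∂(u α) = ∂(g β - u
    -- α)`.
    refine (Submodule.Quotient.mk_eq_zero _).2 ⟨postcomp P g β - postcomp P u α, sub_mem ?_ ?_, ?_⟩
    · simpa using postcomp_mem_convFil F 0 hg hge hβ
    · exact postcomp_mem_convFil F (-1) hu hue hα
    · have h1 := convD_postcomp (P := P) (p - 1) hgd β
      have h2 := convD_postcomp_add_postcomp_convD p u α
      rw [hdα, postcomp_zero, add_zero] at h2
      change convD P A (p - 1) _ = α
      rw [map_sub, ← h1, h2, hβα]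
      funext S ξ
      ext x
      exact Eq.trans (sub_add_eq_sub_sub _ _ _) (hgf S ξ (α S ξ x))
  · intro ω
    obtain ⟨⟨β, hβ, hdβ⟩, rfl⟩ := Submodule.Quotient.mk_surjective _ ω
    have hdβ : convD P B p β = 0 := hdβ
    have hgβ : postcomp P g β ∈ convFil F A m p := by
      simpa using postcomp_mem_convFil F 0 hg hge hβ
    refine ⟨Submodule.Quotient.mk ⟨postcomp P g β, hgβ, ?_⟩, ?_⟩
    · change convD P A p _ = 0
      rw [← convD_postcomp p hgd, hdβ, postcomp_zero]
    -- As `∂β = 0`, the formula for `f g` reads `f g β - β = ∂(-t β)`.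
    · refine (Submodule.Quotient.eq _).2
        ⟨-postcomp P t β, neg_mem (postcomp_mem_convFil F (-1) ht hte hβ), ?_⟩
      have h2 := convD_postcomp_add_postcomp_convD p t β
      rw [hdβ, postcomp_zero, add_zero] at h2
      change convD P B (p - 1) _ = pushforward P f (postcomp P g β) - β
      rw [map_neg, h2]
      funext S ξ
      ext x
      have h3 := hfg S ξ (β S ξ x)
      change -(B.d S ξ (t S ξ (β S ξ x)) + t S ξ (B.d S ξ (β S ξ x))) =
        f.app S ξ (g S ξ (β S ξ x)) - β S ξ x
      rw [add_assoc] at h3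
      rw [eq_sub_iff_add_eq'.2 h3, neg_sub]

end QuasiIso

end ConvOperad

theorem mainTheorem7 {K : Type*} [Field K] [CharZero K] {Ξ : Type*}
    (P : ConvOperad.DGPseudoCooperad K Ξ) (F : P.Filtration)
    (A B : ConvOperad.DGOperad K Ξ) (f : A.Hom B) (hf : f.IsQuasiIso) (m : ℕ) (hm : 1 ≤ m) :
    -- `F_m Conv(P, A)` and `F_m Conv(P, B)` are closed under the brackets
    (∀ p q, ∀ φ ∈ ConvOperad.convFil F A m p, ∀ ψ ∈ ConvOperad.convFil F A m q,
      ConvOperad.convBracket P A p q φ ψ ∈ ConvOperad.convFil F A m (p + q)) ∧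
    (∀ p q, ∀ φ ∈ ConvOperad.convFil F B m p, ∀ ψ ∈ ConvOperad.convFil F B m q,
      ConvOperad.convBracket P B p q φ ψ ∈ ConvOperad.convFil F B m (p + q)) ∧
    -- `f_*` preserves the brackets
    (∀ p q, ∀ φ ∈ ConvOperad.convFil F A m p, ∀ ψ ∈ ConvOperad.convFil F A m q,
      ConvOperad.pushforward P f (ConvOperad.convBracket P A p q φ ψ) =
        ConvOperad.convBracket P B p q
          (ConvOperad.pushforward P f φ) (ConvOperad.pushforward P f ψ)) ∧
    -- `f_*` is a quasi-isomorphism of cochain complexes `F_m Conv(P, A) → F_m Conv(P, B)`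
    ConvOperad.IsQuasiIso
      (ConvOperad.convFil F A m) (ConvOperad.convD P A)
      (ConvOperad.convFil F B m) (ConvOperad.convD P B)
      (ConvOperad.pushforward P f) := by
  exact ⟨fun _ _ _ hφ _ hψ => ConvOperad.convBracket_mem_convFil F hφ hψ,
    fun _ _ _ hφ _ hψ => ConvOperad.convBracket_mem_convFil F hφ hψ,
    fun p q φ _ ψ _ => ConvOperad.pushforward_convBracket f p q φ ψ,
    ConvOperad.isQuasiIso_pushforward F m hf⟩
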